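/- Let $d \in \mathbb{N}$. Let $H^2_d$ be the Drury--Arveson space, that is, the Hilbert space of all power series $f = \sum_{\alpha \in \mathbb{N}^d} a_\alpha z^\alpha$ in $d$ complex variables with $$\|f\|^2 = \sum_{\alpha \in \mathbb{N}^d} |a_\alpha|^2 \, \frac{\alpha!}{|\alpha|!} < \infty ,$$ where $\alpha! = \alpha_1! \cdots \alpha_d!$ and $|\alpha| = \alpha_1 + \cdots + \alpha_d$. For $1 \le i \le d$ let $M_{z_i} \colon H^2_d \to H^2_d$, $f \mapsto z_i f$, be the (bounded) operator of multiplication by the coordinate $z_i$. Let $\mathcal{T}_d$ be the Toeplitz $C^*$-algebra, that is, the unital $C^*$-subalgebra of $B(H^2_d)$ generated by $M_{z_1}, \ldots, M_{z_d}$, let $\mathcal{K}$ be the ideal of compact operators in $B(H^2_d)$, and let $\partial \mathbb{B}_d = \{ z \in \mathbb{C}^d : \|z\|_2 = 1 \}$ be the Euclidean unit sphere. Then $\mathcal{K} \subset \mathcal{T}_d$, and there is a short exact sequence of $C^*$-algebras $$0 \longrightarrow \mathcal{K} \longrightarrow \mathcal{T}_d \longrightarrow C(\partial \mathbb{B}_d)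 \longrightarrow 0,$$ in which the first map is the inclusion and the second map is a unital $*$-homomorphism that sends $M_{z_i}$ to the coordinate function $z_i$ for every $1 \le i \le d$. -/

import Mathlib

open scoped Nat ENNReal ComplexConjugate

noncomputable section

namespace DruryArveson

/-- The weight `α! / |α|!` of a multi-index `α ∈ ℕ^d`, where `α! = α₁! ⋯ α_d!` and
`|α| = α₁ + ⋯ + α_d`. -/
def weight {d : ℕ} (α : Fin d →₀ ℕ) : ℝ :=
  (∏ i, ((α i)! : ℝ)) / ((∑ i, α i)! : ℝ)

lemma weight_pos {d : ℕ} (α : Fin d →₀ ℕ) : 0 < weight α :=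
  div_pos (Finset.prod_pos fun i _ => by exact_mod_cast Nat.factorial_pos _)
    (by exact_mod_cast Nat.factorial_pos _)

lemma sum_add_single {d : ℕ} (i : Fin d) (α : Fin d →₀ ℕ) :
    ∑ j, (Finsupp.single i 1 + α : Fin d →₀ ℕ) j = (∑ j, α j) + 1 := by
  simp only [Finsupp.add_apply, Finset.sum_add_distrib]
  rw [add_comm]
  congr 1
  rw [Finset.sum_eq_single i] <;> simp +contextual [eq_comm]

lemma prod_add_single {d : ℕ} (i : Fin d) (α : Fin d →₀ ℕ) :
    ∏ j, (((Finsupp.single i 1 + α : Fin d →₀ ℕ) j)! : ℝ) = (α i + 1) * ∏ j, ((α j)! : ℝ) := by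
  classical
  rw [← Finset.mul_prod_erase _ _ (Finset.mem_univ i),
    ← Finset.mul_prod_erase Finset.univ (fun j => ((α j)! : ℝ)) (Finset.mem_univ i), ← mul_assoc]
  congr 1
  · simp [add_comm 1 (α i), Nat.factorial_succ]
  · refine Finset.prod_congr rfl fun j hj => ?_
    have : j ≠ i := Finset.ne_of_mem_erase hj
    simp [this.symm]

/-- `‖z_i z^α‖ ≤ ‖z^α‖`. -/
lemma weight_add_single_le {d : ℕ} (i : Fin d) (α : Fin d →₀ ℕ) :
    weight (Finsupp.single i 1 + α) ≤ weight α := by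
  have h1 : (0 : ℝ) < ∏ j, ((α j)! : ℝ) :=
    Finset.prod_pos fun i _ => by exact_mod_cast Nat.factorial_pos _
  have h2 : (0 : ℝ) < ((∑ j, α j)! : ℝ) := by exact_mod_cast Nat.factorial_pos _
  have h3 : (α i : ℝ) ≤ ((∑ j, α j : ℕ) : ℝ) := by
    exact_mod_cast Finset.single_le_sum (f := fun j => α j) (fun _ _ => Nat.zero_le _)
      (Finset.mem_univ i)
  unfold weight
  rw [sum_add_single, prod_add_single, Nat.factorial_succ, Nat.cast_mul, div_le_div_iff₀
    (by positivity) h2]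
  push_cast at h3 ⊢
  nlinarith [mul_pos h1 h2]

/-- The coefficient sequence of a power series, rescaled so that the Drury--Arveson norm becomes
the norm of `ℓ²`. -/
def scaledCoeff {d : ℕ} (f : MvPowerSeries (Fin d) ℂ) : (Fin d →₀ ℕ) → ℂ :=
  fun α => (√(weight α) : ℂ) * MvPowerSeries.coeff α f

lemma norm_scaledCoeff_sq {d : ℕ} (f : MvPowerSeries (Fin d) ℂ) (α : Fin d →₀ ℕ) :
    ‖scaledCoeff f α‖ ^ 2 = weight α * ‖MvPowerSeries.coeff α f‖ ^ 2 := by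
  rw [scaledCoeff, norm_mul, mul_pow, Complex.norm_real, Real.norm_eq_abs, sq_abs,
    Real.sq_sqrt (weight_pos α).le]

lemma memℓp_scaledCoeff_iff {d : ℕ} (f : MvPowerSeries (Fin d) ℂ) :
    Memℓp (scaledCoeff f) 2 ↔
      Summable fun α => weight α * ‖MvPowerSeries.coeff α f‖ ^ 2 := by
  rw [memℓp_gen_iff (by norm_num)]
  simp only [ENNReal.toReal_ofNat, Real.rpow_ofNat, norm_scaledCoeff_sq]

lemma scaledCoeff_add {d : ℕ} (f g : MvPowerSeries (Fin d) ℂ) :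
    scaledCoeff (f + g) = scaledCoeff f + scaledCoeff g := by
  ext α; simp [scaledCoeff, mul_add]

lemma scaledCoeff_smul {d : ℕ} (c : ℂ) (f : MvPowerSeries (Fin d) ℂ) :
    scaledCoeff (c • f) = c • scaledCoeff f := by
  ext α; simp [scaledCoeff]; ring

/-- The linear space of power series `f = ∑ a_α z^α` in `d` variables such that
`∑ |a_α|² α! / |α|! < ∞`. -/
def powerSeriesSubmodule (d : ℕ) : Submodule ℂ (MvPowerSeries (Fin d) ℂ) where
  carrier := {f | Summable fun α => weight α * ‖MvPowerSeries.coeff α f‖ ^ 2}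
  add_mem' {f g} hf hg := by
    simp only [Set.mem_ofPred_eq, ← memℓp_scaledCoeff_iff, scaledCoeff_add] at *
    exact hf.add hg
  zero_mem' := by simp
  smul_mem' c f hf := by
    simp only [Set.mem_ofPred_eq, ← memℓp_scaledCoeff_iff, scaledCoeff_smul] at *
    exact hf.const_smul c

end DruryArveson

/-- The Drury--Arveson space `H²_d`: power series `f = ∑ a_α z^α` in `d` complex variables with
`∑ |a_α|² α! / |α|! < ∞`. -/
def DruryArveson (d : ℕ) : Type := DruryArveson.powerSeriesSubmodule d

namespace DruryArveson

variable {d : ℕ}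

instance : AddCommGroup (DruryArveson d) :=
  inferInstanceAs (AddCommGroup (powerSeriesSubmodule d))

instance : Module ℂ (DruryArveson d) :=
  inferInstanceAs (Module ℂ (powerSeriesSubmodule d))

/-- The power series underlying an element of the Drury--Arveson space. -/
def toSeries : DruryArveson d →ₗ[ℂ] MvPowerSeries (Fin d) ℂ := (powerSeriesSubmodule d).subtype

lemma toSeries_injective : Function.Injective (toSeries (d := d)) := Subtype.val_injective

/-- The coefficient `a_α` of `f = ∑ a_α z^α ∈ H²_d`. -/
def coeff (α : Fin d →₀ ℕ) (f : DruryArveson d) : ℂ := MvPowerSeries.coeff α (toSeries f)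

lemma summable_norm_sq (f : DruryArveson d) : Summable fun α => weight α * ‖coeff α f‖ ^ 2 :=
  f.2

/-- The linear isomorphism of `H²_d` with `ℓ²` given by rescaling the coefficients. -/
def toL2 (d : ℕ) : DruryArveson d ≃ₗ[ℂ] lp (fun _ : Fin d →₀ ℕ => ℂ) 2 where
  toFun f := ⟨scaledCoeff (toSeries f), (memℓp_scaledCoeff_iff _).2 f.2⟩
  map_add' f g := Subtype.ext (by simp only [map_add, scaledCoeff_add]; rfl)
  map_smul' c f := Subtype.ext (by simp only [map_smul, scaledCoeff_smul]; rfl)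
  invFun x := ⟨fun α => ((√(weight α))⁻¹ : ℂ) * x α, by
    refine (memℓp_scaledCoeff_iff _).1 ?_
    convert! lp.memℓp x using 1
    ext α
    have : (√(weight α) : ℂ) ≠ 0 := by
      exact_mod_cast (Real.sqrt_pos.2 (weight_pos α)).ne'
    change (√(weight α) : ℂ) * (((√(weight α))⁻¹ : ℂ) * x α) = _
    rw [mul_inv_cancel_left₀ this]⟩
  left_inv f := by
    refine Subtype.ext (MvPowerSeries.ext fun α => ?_)
    have : (√(weight α) : ℂ) ≠ 0 := by
      exact_mod_cast (Real.sqrt_pos.2 (weight_pos α)).ne'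
    change ((√(weight α))⁻¹ : ℂ) * ((√(weight α) : ℂ) * _) = _
    rw [inv_mul_cancel_left₀ this]; rfl
  right_inv x := by
    refine Subtype.ext (funext fun α => ?_)
    have : (√(weight α) : ℂ) ≠ 0 := by
      exact_mod_cast (Real.sqrt_pos.2 (weight_pos α)).ne'
    change (√(weight α) : ℂ) * (((√(weight α))⁻¹ : ℂ) * x α) = _
    rw [mul_inv_cancel_left₀ this]

lemma toL2_apply (f : DruryArveson d) (α : Fin d →₀ ℕ) :
    toL2 d f α = (√(weight α) : ℂ) * coeff α f := rfl

/-- The inner product `⟨f, g⟩ = ∑ conj (a_α) b_α α! / |α|!` of `f = ∑ a_α z^α` and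
`g = ∑ b_α z^α` (conjugate-linear in the first argument, as everywhere in the library). -/
def innerProd (f g : DruryArveson d) : ℂ :=
  ∑' α, (weight α : ℂ) * (conj (coeff α f) * coeff α g)

lemma innerProd_eq (f g : DruryArveson d) :
    innerProd f g = inner ℂ (toL2 d f) (toL2 d g) := by
  rw [innerProd, lp.inner_eq_tsum]
  refine tsum_congr fun α => ?_
  have : (weight α : ℂ) = (√(weight α) : ℂ) * (√(weight α) : ℂ) := by
    exact_mod_cast (Real.mul_self_sqrt (weight_pos α).le).symm
  simp only [toL2_apply, RCLike.inner_apply, map_mul, Complex.conj_ofReal, this]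
  ring

/-- The axioms of an inner product for `⟨·, ·⟩` on `H²_d`. -/
@[reducible]
def innerCore (d : ℕ) : InnerProductSpace.Core ℂ (DruryArveson d) where
  inner := innerProd
  conj_inner_symm f g := by simp only [innerProd_eq, inner_conj_symm]
  re_inner_nonneg f := by
    rw [innerProd_eq]; exact inner_self_nonneg
  add_left f g h := by simp only [innerProd_eq, map_add, inner_add_left]
  smul_left f g c := by simp only [innerProd_eq, map_smul, inner_smul_left]
  definite f h := by
    rw [innerProd_eq, inner_self_eq_zero] at h
    exact (toL2 d).map_eq_zero_iff.1 h

instance : NormedAddCommGroup (DruryArveson d) := (innerCore d).toNormedAddCommGroup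

instance : InnerProductSpace ℂ (DruryArveson d) := InnerProductSpace.ofCore (innerCore d).toCore

lemma inner_def (f g : DruryArveson d) :
    inner ℂ f g = ∑' α, (weight α : ℂ) * (conj (coeff α f) * coeff α g) := rfl

lemma inner_eq_inner_toL2 (f g : DruryArveson d) :
    inner ℂ f g = inner ℂ (toL2 d f) (toL2 d g) := innerProd_eq f g

lemma norm_toL2 (f : DruryArveson d) : ‖toL2 d f‖ = ‖f‖ := by
  rw [@norm_eq_sqrt_re_inner ℂ, @norm_eq_sqrt_re_inner ℂ _ _ _ _ f, inner_eq_inner_toL2]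

/-- `‖f‖² = ∑ |a_α|² α! / |α|!`. -/
lemma hasSum_norm_sq (f : DruryArveson d) :
    HasSum (fun α => weight α * ‖coeff α f‖ ^ 2) (‖f‖ ^ 2) := by
  have h := lp.hasSum_norm (p := 2) (by norm_num) (toL2 d f)
  rw [norm_toL2] at h
  simp only [ENNReal.toReal_ofNat, Real.rpow_ofNat] at h
  convert! h using 2 with α
  exact (norm_scaledCoeff_sq (toSeries f) α).symm

instance : CompleteSpace (DruryArveson d) :=
  (LinearIsometryEquiv.mk (toL2 d) norm_toL2).toIsometryEquiv.completeSpace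

lemma coeff_X_mul_add (i : Fin d) (f : MvPowerSeries (Fin d) ℂ) (α : Fin d →₀ ℕ) :
    MvPowerSeries.coeff (Finsupp.single i 1 + α) (MvPowerSeries.X i * f) =
      MvPowerSeries.coeff α f := by
  rw [MvPowerSeries.X, MvPowerSeries.coeff_add_monomial_mul, one_mul]

lemma coeff_X_mul_of_notMem (i : Fin d) (f : MvPowerSeries (Fin d) ℂ) (β : Fin d →₀ ℕ)
    (hβ : β ∉ Set.range fun α : Fin d →₀ ℕ => Finsupp.single i 1 + α) :
    MvPowerSeries.coeff β (MvPowerSeries.X i * f) = 0 := by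
  classical
  rw [MvPowerSeries.X, MvPowerSeries.coeff_monomial_mul, if_neg]
  intro h
  exact hβ ⟨β - Finsupp.single i 1, add_tsub_cancel_of_le h⟩

lemma summable_X_mul (i : Fin d) (f : DruryArveson d) :
    Summable fun β => weight β *
      ‖MvPowerSeries.coeff β (MvPowerSeries.X i * toSeries f)‖ ^ 2 := by
  refine ((add_right_injective (Finsupp.single i 1)).summable_iff fun β hβ => ?_).1 ?_
  · simp [coeff_X_mul_of_notMem i _ β hβ]
  · refine Summable.of_nonneg_of_le (fun α => ?_) (fun α => ?_) (summable_norm_sq f)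
    · exact mul_nonneg (weight_pos _).le (sq_nonneg _)
    · simp only [Function.comp_apply, coeff_X_mul_add]
      exact mul_le_mul_of_nonneg_right (weight_add_single_le i α) (sq_nonneg _)

/-- Multiplication by the coordinate `z_i`, as a linear map on `H²_d`. -/
def mulCoordLinear (i : Fin d) : DruryArveson d →ₗ[ℂ] DruryArveson d where
  toFun f := ⟨MvPowerSeries.X i * toSeries f, summable_X_mul i f⟩
  map_add' f g := Subtype.ext (by simp [mul_add]; rfl)
  map_smul' c f := Subtype.ext (by simp; rfl)

lemma toSeries_mulCoordLinear (i : Fin d) (f : DruryArveson d) :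
    toSeries (mulCoordLinear i f) = MvPowerSeries.X i * toSeries f := rfl

lemma norm_mulCoordLinear_le (i : Fin d) (f : DruryArveson d) : ‖mulCoordLinear i f‖ ≤ ‖f‖ := by
  refine le_of_sq_le_sq ?_ (norm_nonneg f)
  have hinj := add_right_injective (Finsupp.single i 1 : Fin d →₀ ℕ)
  have h1 := hasSum_norm_sq (mulCoordLinear i f)
  rw [← hinj.hasSum_iff fun β hβ => by
    simp [coeff, toSeries_mulCoordLinear, coeff_X_mul_of_notMem i _ β hβ]] at h1
  refine hasSum_le (fun α => ?_) h1 (hasSum_norm_sq f)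
  simp only [Function.comp_apply, coeff, toSeries_mulCoordLinear, coeff_X_mul_add]
  exact mul_le_mul_of_nonneg_right (weight_add_single_le i α) (sq_nonneg _)

/-- The multiplication operator `M_{z_i} : H²_d → H²_d`, `f ↦ z_i f`. -/
def mulCoord (i : Fin d) : DruryArveson d →L[ℂ] DruryArveson d :=
  (mulCoordLinear i).mkContinuous 1 fun f => by
    rw [one_mul]; exact norm_mulCoordLinear_le i f

lemma toSeries_mulCoord (i : Fin d) (f : DruryArveson d) :
    toSeries (mulCoord i f) = MvPowerSeries.X i * toSeries f := rfl

end DruryArveson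

/-- The adjoint of a compact operator on a Hilbert space is compact. -/
lemma isCompactOperator_star {H : Type*} [NormedAddCommGroup H] [InnerProductSpace ℂ H]
    [CompleteSpace H] (T : H →L[ℂ] H) (hT : IsCompactOperator T) :
    IsCompactOperator (star T : H →L[ℂ] H) := by
  have hS : IsCompactOperator (T * star T : H →L[ℂ] H) := hT.comp_clm (star T)
  refine (isCompactOperator_iff_isCompact_closure_image_closedBall
    ((star T : H →L[ℂ] H) : H →ₗ[ℂ] H) one_pos).2 ?_
  have h1 := (hS.isCompact_closure_image_closedBall
    (f := ((T * star T : H →L[ℂ] H) : H →ₗ[ℂ] H)) 1).totallyBounded.subset subset_closure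
  refine (TotallyBounded.closure ?_).isCompact_of_isClosed isClosed_closure
  rw [Metric.totallyBounded_iff]
  intro ε hε
  obtain ⟨t, hts, htf, hcov⟩ := Metric.finite_approx_of_totallyBounded h1 (ε ^ 2 / 2) (by positivity)
  obtain ⟨u, hu, huf, rfl⟩ := Set.exists_subset_image_finite_and.1 ⟨t, hts, htf, rfl⟩
  refine ⟨(star T : H →L[ℂ] H) '' u, huf.image _, ?_⟩
  rintro _ ⟨x, hx, rfl⟩
  have hx' := hcov (Set.mem_image_of_mem _ hx)
  simp only [Set.mem_iUnion, Set.mem_image, exists_prop, Metric.mem_ball,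
    exists_exists_and_eq_and] at hx' ⊢
  obtain ⟨y, hy, hxy⟩ := hx'
  refine ⟨y, hy, ?_⟩
  rw [dist_eq_norm, ← map_sub] at hxy
  change dist ((star T : H →L[ℂ] H) x) ((star T : H →L[ℂ] H) y) < ε
  rw [dist_eq_norm, ← map_sub]
  have hn : ‖x - y‖ ≤ 2 := by
    have h2 := hu hy
    rw [mem_closedBall_zero_iff] at hx h2
    linarith [norm_sub_le x y]
  have key : ‖(star T : H →L[ℂ] H) (x - y)‖ ^ 2 ≤
      ‖(T * star T : H →L[ℂ] H) (x - y)‖ * ‖x - y‖ := by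
    rw [← inner_self_eq_norm_sq (𝕜 := ℂ)]
    conv_lhs => rw [ContinuousLinearMap.star_eq_adjoint, ContinuousLinearMap.adjoint_inner_right]
    exact (RCLike.re_le_norm _).trans (norm_inner_le_norm _ _)
  have h3 : ‖(T * star T : H →L[ℂ] H) (x - y)‖ < ε ^ 2 / 2 := hxy
  refine lt_of_pow_lt_pow_left₀ 2 hε.le ?_
  nlinarith [norm_nonneg ((T * star T : H →L[ℂ] H) (x - y))]

namespace DruryArveson

/-- The `C*`-algebra `𝒦` of compact operators on `H²_d`. -/
def compactOperators (d : ℕ) :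
    NonUnitalStarSubalgebra ℂ (DruryArveson d →L[ℂ] DruryArveson d) where
  carrier := {T | IsCompactOperator T}
  add_mem' hS hT := hS.add hT
  zero_mem' := isCompactOperator_zero
  mul_mem' {_ T} hS _ := hS.comp_clm T
  smul_mem' c _ hT := hT.smul c
  star_mem' {T} hT := isCompactOperator_star T hT

instance (d : ℕ) : IsClosed (compactOperators d : Set (DruryArveson d →L[ℂ] DruryArveson d)) :=
  isClosed_setOfPred_isCompactOperator

/-- The Toeplitz `C*`-algebra `𝒯_d`: the unital `C*`-subalgebra of `B(H²_d)` generated by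
`M_{z_1}, …, M_{z_d}`. -/
def toeplitzAlgebra (d : ℕ) : StarSubalgebra ℂ (DruryArveson d →L[ℂ] DruryArveson d) :=
  (StarAlgebra.adjoin ℂ (Set.range (mulCoord (d := d)))).topologicalClosure

instance (d : ℕ) : IsClosed (toeplitzAlgebra d : Set (DruryArveson d →L[ℂ] DruryArveson d)) :=
  StarSubalgebra.isClosed_topologicalClosure _

/-- `M_{z_i}` as an element of `𝒯_d`. -/
def toeplitzCoord {d : ℕ} (i : Fin d) : toeplitzAlgebra d :=
  ⟨mulCoord i, StarSubalgebra.le_topologicalClosure _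
    (StarAlgebra.subset_adjoin ℂ _ (Set.mem_range_self i))⟩

/-- The coordinate function `z_i` on the unit sphere `∂𝔹_d` of `ℂ^d`. -/
def sphereCoord {d : ℕ} (i : Fin d) : C(Metric.sphere (0 : EuclideanSpace ℂ (Fin d)) 1, ℂ) where
  toFun z := z.1 i
  continuous_toFun := by fun_prop

end DruryArveson

/-- `0 ⟶ A ⟶ B ⟶ C ⟶ 0` is a short exact sequence of `C*`-algebras. -/
structure IsCStarShortExact {A B C : Type*} [NonUnitalCStarAlgebra A] [NonUnitalCStarAlgebra B]
    [NonUnitalCStarAlgebra C] (ι : A →⋆ₙₐ[ℂ] B) (π : B →⋆ₙₐ[ℂ] C) : Prop where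
  injective : Function.Injective ι
  exact : Function.Exact ι π
  surjective : Function.Surjective π

end

noncomputable section

namespace Ideal.Quotient

section NonComm

variable {A : Type*} [NormedRing A] (I : Ideal A) [I.IsTwoSided]

lemma exists_mk_eq_norm_lt (x : A ⧸ I) {ε : ℝ} (hε : 0 < ε) :
    ∃ a : A, Ideal.Quotient.mk I a = x ∧ ‖a‖ < ‖x‖ + ε :=
  Submodule.Quotient.norm_mk_lt x hε

lemma norm_mk_le_norm (a : A) : ‖Ideal.Quotient.mk I a‖ ≤ ‖a‖ :=
  Submodule.Quotient.norm_mk_le I a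

lemma norm_mul_le_norm_mul_norm (x y : A ⧸ I) : ‖x * y‖ ≤ ‖x‖ * ‖y‖ := by
  have key : ∀ ε : ℝ, 0 < ε → ‖x * y‖ ≤ (‖x‖ + ε) * (‖y‖ + ε) := fun ε hε => by
    obtain ⟨a, rfl, ha⟩ := exists_mk_eq_norm_lt I x hε
    obtain ⟨b, rfl, hb⟩ := exists_mk_eq_norm_lt I y hε
    rw [← map_mul]
    refine (norm_mk_le_norm I _).trans ((norm_mul_le a b).trans ?_)
    gcongr
  have hlim : Filter.Tendsto (fun ε : ℝ => (‖x‖ + ε) * (‖y‖ + ε)) (nhdsWithin 0 (Set.Ioi 0))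
      (nhds ((‖x‖ + 0) * (‖y‖ + 0))) := by
    refine Filter.Tendsto.mono_left ?_ nhdsWithin_le_nhds
    exact Continuous.tendsto (by fun_prop) 0
  rw [add_zero, add_zero] at hlim
  exact ge_of_tendsto hlim (Filter.eventually_of_mem self_mem_nhdsWithin key)

end NonComm

variable {A : Type*} [CStarAlgebra A] (I : Ideal A) [I.IsTwoSided]

/-- The involution on the quotient by a self-adjoint two-sided ideal. -/
@[reducible]
def starRingOfStarMem (hstar : ∀ a ∈ I, star a ∈ I) : StarRing (A ⧸ I) where
  star := Quotient.map' star fun a b h => by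
    rw [Submodule.quotientRel_def] at h ⊢
    rw [← star_sub]
    exact hstar _ h
  star_involutive x := by
    obtain ⟨a, rfl⟩ := Ideal.Quotient.mk_surjective x
    exact congrArg (Ideal.Quotient.mk I) (star_star a)
  star_mul x y := by
    obtain ⟨a, rfl⟩ := Ideal.Quotient.mk_surjective x
    obtain ⟨b, rfl⟩ := Ideal.Quotient.mk_surjective y
    exact congrArg (Ideal.Quotient.mk I) (star_mul a b)
  star_add x y := by
    obtain ⟨a, rfl⟩ := Ideal.Quotient.mk_surjective x
    obtain ⟨b, rfl⟩ := Ideal.Quotient.mk_surjective y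
    exact congrArg (Ideal.Quotient.mk I) (star_add a b)

/-- The `C*`-inequality in the quotient by an ideal with a right approximate unit. -/
lemma norm_mk_mul_norm_mk_le (h : ∀ k ∈ I, ∀ ε > 0, ∃ e ∈ I, ‖1 - e‖ ≤ 1 ∧ ‖k * (1 - e)‖ ≤ ε)
    (a : A) : ‖mk I a‖ * ‖mk I a‖ ≤ ‖mk I (star a * a)‖ := by
  refine le_of_forall_pos_le_add fun ε hε => ?_
  obtain ⟨b, hb, hbn⟩ := exists_mk_eq_norm_lt I (mk I (star a * a)) (half_pos hε)
  obtain ⟨e, he, he1, hke⟩ := h (star a * a - b) (Ideal.Quotient.eq.1 hb.symm) _ (half_pos hε)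
  have h1 : mk I a = mk I (a * (1 - e)) :=
    Ideal.Quotient.eq.2 (by simpa [mul_sub] using I.mul_mem_left a he)
  have h2 : ‖mk I a‖ ≤ ‖a * (1 - e)‖ := h1 ▸ norm_mk_le_norm I _
  calc ‖mk I a‖ * ‖mk I a‖ ≤ ‖a * (1 - e)‖ * ‖a * (1 - e)‖ := by gcongr
    _ = ‖star (1 - e) * (star a * a * (1 - e))‖ := by
        rw [← CStarRing.norm_star_mul_self, star_mul]; simp only [mul_assoc]
    _ ≤ ‖star (1 - e)‖ * ‖star a * a * (1 - e)‖ := norm_mul_le _ _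
    _ ≤ 1 * ‖star a * a * (1 - e)‖ := by rw [norm_star]; gcongr
    _ = ‖b * (1 - e) + (star a * a - b) * (1 - e)‖ := by rw [one_mul, ← add_mul, add_sub_cancel]
    _ ≤ ‖b‖ * ‖1 - e‖ + ‖(star a * a - b) * (1 - e)‖ :=
        (norm_add_le _ _).trans (by gcongr; exact norm_mul_le _ _)
    _ ≤ ‖b‖ * 1 + ε / 2 := by gcongr
    _ ≤ ‖mk I (star a * a)‖ + ε := by linarith

/-- The quotient of a `C*`-algebra by a closed self-adjoint two-sided ideal with an approximate
unit which contains all commutators is a commutative `C*`-algebra. -/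
def commCStarAlgebra (hI : IsClosed (I : Set A)) (hstar : ∀ a ∈ I, star a ∈ I)
    (h : ∀ k ∈ I, ∀ ε > 0, ∃ e ∈ I, ‖1 - e‖ ≤ 1 ∧ ‖k * (1 - e)‖ ≤ ε)
    (hcomm : ∀ a b : A, a * b - b * a ∈ I) : CommCStarAlgebra (A ⧸ I) :=
  letI : NormedCommRing (A ⧸ I) :=
    { @Submodule.Quotient.normedAddCommGroup A _ A _ _ I hI,
      (inferInstance : Ring (A ⧸ I)) with
      norm_mul_le := norm_mul_le_norm_mul_norm I
      mul_comm := fun x y => by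
        obtain ⟨a, rfl⟩ := Ideal.Quotient.mk_surjective x
        obtain ⟨b, rfl⟩ := Ideal.Quotient.mk_surjective y
        exact Ideal.Quotient.eq.2 (hcomm a b) }
  letI : StarRing (A ⧸ I) := starRingOfStarMem I hstar
  { toStarRing := starRingOfStarMem I hstar
    toAlgebra := Ideal.Quotient.algebra ℂ
    norm_smul_le := fun c x => by
      have := (Submodule.Quotient.normedSpace I ℂ).norm_smul_le c x
      exact this
    toCompleteSpace := Submodule.Quotient.completeSpace I
    norm_mul_self_le := fun x => by
      obtain ⟨a, rfl⟩ := Ideal.Quotient.mk_surjective x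
      exact norm_mk_mul_norm_mk_le I h a
    star_smul := fun c x => by
      obtain ⟨a, rfl⟩ := Ideal.Quotient.mk_surjective x
      exact congrArg (Ideal.Quotient.mk I) (star_smul c a) }

end Ideal.Quotient

/-- Rank-one operators are compact. -/
lemma isCompactOperator_rankOne {H : Type*} [NormedAddCommGroup H] [InnerProductSpace ℂ H]
    (x y : H) : IsCompactOperator (InnerProductSpace.rankOne ℂ x y : H →L[ℂ] H) := by
  have h : IsCompactOperator (id : ℂ → ℂ) :=
    (isCompactOperator_id_iff_finiteDimensional (𝕜 := ℂ)).2 inferInstance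
  exact (h.comp_clm (innerSL ℂ y)).clm_comp (ContinuousLinearMap.toSpanSingleton ℂ x)

namespace DruryArveson

variable {d : ℕ}

/-! ### Coefficients and monomials -/

/-- The coefficient functional as a linear map. -/
def coeffLinear (α : Fin d →₀ ℕ) : DruryArveson d →ₗ[ℂ] ℂ :=
  (MvPowerSeries.coeff α).comp toSeries

lemma coeff_add (α : Fin d →₀ ℕ) (f g : DruryArveson d) :
    coeff α (f + g) = coeff α f + coeff α g := (coeffLinear α).map_add f g

lemma coeff_sub (α : Fin d →₀ ℕ) (f g : DruryArveson d) :
    coeff α (f - g) = coeff α f - coeff α g := (coeffLinear α).map_sub f g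

lemma coeff_smul (α : Fin d →₀ ℕ) (c : ℂ) (f : DruryArveson d) :
    coeff α (c • f) = c * coeff α f := (coeffLinear α).map_smul c f

lemma coeff_sum {ι : Type*} (s : Finset ι) (α : Fin d →₀ ℕ) (f : ι → DruryArveson d) :
    coeff α (∑ i ∈ s, f i) = ∑ i ∈ s, coeff α (f i) := map_sum (coeffLinear α) f s

lemma ext_coeff {f g : DruryArveson d} (h : ∀ α, coeff α f = coeff α g) : f = g :=
  toSeries_injective (MvPowerSeries.ext h)

/-- The monomial `z^α`. -/
def mono (α : Fin d →₀ ℕ) : DruryArveson d :=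
  ⟨MvPowerSeries.monomial α 1, by
    classical
    refine summable_of_ne_finset_zero (s := {α}) fun β hβ => ?_
    rw [MvPowerSeries.coeff_monomial_ne (by simpa using hβ)]
    simp⟩

open Classical in
lemma coeff_mono (α β : Fin d →₀ ℕ) : coeff β (mono α) = if β = α then 1 else 0 :=
  MvPowerSeries.coeff_monomial β α 1

lemma inner_mono (α : Fin d →₀ ℕ) (f : DruryArveson d) :
    inner ℂ (mono α) f = (weight α : ℂ) * coeff α f := by
  rw [inner_def, tsum_eq_single α]
  · simp [coeff_mono]
  · intro β hβ
    simp [coeff_mono, hβ]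

lemma coeff_eq_inner (α : Fin d →₀ ℕ) (f : DruryArveson d) :
    coeff α f = (weight α : ℂ)⁻¹ * inner ℂ (mono α) f := by
  have : (weight α : ℂ) ≠ 0 := by exact_mod_cast (weight_pos α).ne'
  rw [inner_mono, inv_mul_cancel_left₀ this]

lemma norm_le_of_norm_coeff_le {f g : DruryArveson d} {C : ℝ} (hC : 0 ≤ C)
    (h : ∀ α, ‖coeff α f‖ ≤ C * ‖coeff α g‖) : ‖f‖ ≤ C * ‖g‖ := by
  refine le_of_sq_le_sq ?_ (by positivity)
  rw [mul_pow]
  refine hasSum_le (fun α => ?_) (hasSum_norm_sq f) ((hasSum_norm_sq g).mul_left (C ^ 2))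
  calc weight α * ‖coeff α f‖ ^ 2 ≤ weight α * (C * ‖coeff α g‖) ^ 2 := by
        have := (weight_pos α).le
        gcongr
        exact h α
    _ = _ := by ring

lemma coeff_mulCoord_add (i : Fin d) (f : DruryArveson d) (α : Fin d →₀ ℕ) :
    coeff (Finsupp.single i 1 + α) (mulCoord i f) = coeff α f :=
  coeff_X_mul_add i _ α

lemma coeff_mulCoord_of_eq_zero (i : Fin d) (f : DruryArveson d) {α : Fin d →₀ ℕ} (h : α i = 0) :
    coeff α (mulCoord i f) = 0 :=
  coeff_X_mul_of_notMem i _ α (by rintro ⟨β, rfl⟩; simp at h)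

lemma mulCoord_mono (i : Fin d) (α : Fin d →₀ ℕ) :
    mulCoord i (mono α) = mono (Finsupp.single i 1 + α) :=
  toSeries_injective <| by
    rw [toSeries_mulCoord]
    exact (MvPowerSeries.monomial_mul_monomial (Finsupp.single i 1) α (1 : ℂ) 1).trans
      (by rw [one_mul]; rfl)

lemma weight_add_single (i : Fin d) (α : Fin d →₀ ℕ) :
    weight (Finsupp.single i 1 + α) = weight α * ((α i + 1) / ((∑ j, α j : ℕ) + 1)) := by
  unfold weight
  rw [sum_add_single, prod_add_single, Nat.factorial_succ, Nat.cast_mul]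
  have : ((∑ j, α j)! : ℝ) ≠ 0 := by positivity
  push_cast
  field_simp

lemma coeff_star_mulCoord (i : Fin d) (f : DruryArveson d) (α : Fin d →₀ ℕ) :
    coeff α (star (mulCoord i) f) =
      (α i + 1) / ((∑ j, α j : ℕ) + 1) * coeff (Finsupp.single i 1 + α) f := by
  rw [coeff_eq_inner, ContinuousLinearMap.star_eq_adjoint, ContinuousLinearMap.adjoint_inner_right,
    mulCoord_mono, inner_mono, weight_add_single]
  have : (weight α : ℂ) ≠ 0 := by exact_mod_cast (weight_pos α).ne'
  push_cast
  field_simp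

/-! ### Diagonal operators -/

/-- The operator multiplying the coefficient of `z^α` by `c α`, for bounded `c`. -/
def diagonal (c : (Fin d →₀ ℕ) → ℂ) (C : ℝ) (hc : ∀ α, ‖c α‖ ≤ C) :
    DruryArveson d →L[ℂ] DruryArveson d :=
  LinearMap.mkContinuous
    { toFun := fun f => ⟨fun α => c α * coeff α f, by
        refine Summable.of_nonneg_of_le (fun α => ?_) (fun α => ?_)
          ((summable_norm_sq f).mul_left (C ^ 2))
        · exact mul_nonneg (weight_pos _).le (sq_nonneg _)
        · change weight α * ‖c α * coeff α f‖ ^ 2 ≤ _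
          have := (weight_pos α).le
          rw [norm_mul]
          calc _ ≤ weight α * (C * ‖coeff α f‖) ^ 2 := by gcongr; exact hc α
            _ = _ := by ring⟩
      map_add' := fun f g => ext_coeff fun α => by
        exact (congrArg (c α * ·) (coeff_add α f g)).trans (mul_add _ _ _)
      map_smul' := fun a f => ext_coeff fun α => by
        exact (congrArg (c α * ·) (coeff_smul α a f)).trans (mul_left_comm _ _ _) }
    C fun f => norm_le_of_norm_coeff_le ((norm_nonneg _).trans (hc 0)) fun α => by
      change ‖c α * coeff α f‖ ≤ _
      rw [norm_mul]
      gcongr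
      exact hc α

lemma coeff_diagonal (c : (Fin d →₀ ℕ) → ℂ) (C : ℝ) (hc : ∀ α, ‖c α‖ ≤ C) (f : DruryArveson d)
    (α : Fin d →₀ ℕ) : coeff α (diagonal c C hc f) = c α * coeff α f := rfl

/-- The orthogonal projection onto the span of the monomials `z^α`, `α ∈ s`. -/
def proj (s : Finset (Fin d →₀ ℕ)) : DruryArveson d →L[ℂ] DruryArveson d :=
  ∑ α ∈ s, (weight α : ℂ)⁻¹ • InnerProductSpace.rankOne ℂ (mono α) (mono α)

lemma proj_apply (s : Finset (Fin d →₀ ℕ)) (f : DruryArveson d) :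
    proj s f = ∑ α ∈ s, coeff α f • mono α := by
  simp [proj, smul_smul, coeff_eq_inner]

open Classical in
lemma coeff_proj (s : Finset (Fin d →₀ ℕ)) (f : DruryArveson d) (β : Fin d →₀ ℕ) :
    coeff β (proj s f) = if β ∈ s then coeff β f else 0 := by
  simp [proj_apply, coeff_sum, coeff_smul, coeff_mono]

lemma isCompactOperator_proj (s : Finset (Fin d →₀ ℕ)) : IsCompactOperator (proj s) :=
  sum_mem (S := compactOperators d) fun α _ =>
    SMulMemClass.smul_mem (s := compactOperators d) _ (isCompactOperator_rankOne (mono α) (mono α))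

lemma norm_one_sub_proj_le (s : Finset (Fin d →₀ ℕ)) : ‖1 - proj s‖ ≤ 1 := by
  classical
  refine ContinuousLinearMap.opNorm_le_bound _ zero_le_one fun f =>
    norm_le_of_norm_coeff_le zero_le_one fun α => ?_
  rw [one_mul, sub_apply, one_apply_eq_self, coeff_sub, coeff_proj]
  split_ifs <;> simp

lemma star_proj (s : Finset (Fin d →₀ ℕ)) : star (proj s) = proj s := by
  simp [proj, star_sum, ContinuousLinearMap.star_eq_adjoint]

lemma tendsto_proj_apply (f : DruryArveson d) :
    Filter.Tendsto (fun s => proj s f) Filter.atTop (nhds f) := by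
  classical
  have h : ∀ s, ‖proj s f - f‖ ^ 2 = ‖f‖ ^ 2 - ∑ α ∈ s, weight α * ‖coeff α f‖ ^ 2 := fun s => by
    refine (hasSum_norm_sq (proj s f - f)).unique ?_
    have h1 := (hasSum_norm_sq f).sub (hasSum_sum_of_ne_finset_zero (s := s)
      (f := fun α => if α ∈ s then weight α * ‖coeff α f‖ ^ 2 else 0) fun α hα => if_neg hα)
    rw [Finset.sum_congr rfl fun α hα => if_pos hα] at h1
    convert! h1 using 2 with α
    rw [coeff_sub, coeff_proj]
    split_ifs <;> simp
  rw [tendsto_iff_norm_sub_tendsto_zero]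
  have h2 : Filter.Tendsto (fun s => ‖proj s f - f‖ ^ 2) Filter.atTop (nhds 0) := by
    simp only [h]
    rw [← sub_self (‖f‖ ^ 2)]
    exact Filter.Tendsto.const_sub _ (hasSum_norm_sq f)
  simpa using h2.sqrt

/-- A compact operator is approximated in norm by its compressions to finitely many monomials. -/
lemma exists_norm_one_sub_proj_mul_le {T : DruryArveson d →L[ℂ] DruryArveson d}
    (hT : IsCompactOperator T) {ε : ℝ} (hε : 0 < ε) :
    ∃ s₀ : Finset (Fin d →₀ ℕ), ∀ s, s₀ ≤ s → ‖(1 - proj s) * T‖ ≤ ε := by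
  have h1 := (hT.isCompact_closure_image_closedBall
    (f := (T : DruryArveson d →ₗ[ℂ] DruryArveson d)) 1).totallyBounded.subset subset_closure
  obtain ⟨t, -, htf, hcov⟩ := Metric.finite_approx_of_totallyBounded h1 (ε / 2) (by positivity)
  have h2 : ∀ᶠ s in Filter.atTop, ∀ y ∈ t, ‖proj s y - y‖ < ε / 2 := by
    rw [Filter.eventually_all_finite htf]
    intro y _
    exact (tendsto_iff_norm_sub_tendsto_zero.1 (tendsto_proj_apply y)).eventually_lt_const
      (by positivity)
  obtain ⟨s₀, hs₀⟩ := Filter.eventually_atTop.1 h2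
  refine ⟨s₀, fun s hs => ContinuousLinearMap.opNorm_le_of_unit_norm hε.le fun x hx => ?_⟩
  have hx' := hcov (Set.mem_image_of_mem _ (mem_closedBall_zero_iff.2 hx.le))
  simp only [Set.mem_iUnion, Metric.mem_ball, exists_prop] at hx'
  obtain ⟨y, hy, hxy⟩ := hx'
  rw [dist_eq_norm] at hxy
  have h3 := hs₀ s hs y hy
  calc ‖((1 - proj s) * T) x‖ = ‖(1 - proj s) (T x - y) - (proj s y - y)‖ := by
        congr 1; simp; abel
    _ ≤ ‖(1 - proj s) (T x - y)‖ + ‖proj s y - y‖ := norm_sub_le _ _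
    _ ≤ 1 * ‖T x - y‖ + ‖proj s y - y‖ := by
        gcongr
        exact ContinuousLinearMap.le_of_opNorm_le _ (norm_one_sub_proj_le s) _
    _ ≤ ε := by
        have : ‖T x - y‖ < ε / 2 := hxy
        linarith

lemma exists_norm_mul_one_sub_proj_le {T : DruryArveson d →L[ℂ] DruryArveson d}
    (hT : IsCompactOperator T) {ε : ℝ} (hε : 0 < ε) :
    ∃ s₀ : Finset (Fin d →₀ ℕ), ∀ s, s₀ ≤ s → ‖T * (1 - proj s)‖ ≤ ε := by
  obtain ⟨s₀, h⟩ := exists_norm_one_sub_proj_mul_le (isCompactOperator_star T hT) hε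
  refine ⟨s₀, fun s hs => ?_⟩
  rw [← norm_star, star_mul, star_sub, star_proj, star_one]
  exact h s hs

/-- A diagonal operator whose entries tend to zero is compact. -/
lemma isCompactOperator_diagonal (c : (Fin d →₀ ℕ) → ℂ) (C : ℝ) (hc : ∀ α, ‖c α‖ ≤ C)
    (h : ∀ ε > 0, ∃ s : Finset (Fin d →₀ ℕ), ∀ α ∉ s, ‖c α‖ ≤ ε) :
    IsCompactOperator (diagonal c C hc) := by
  classical
  refine (isClosed_setOfPred_isCompactOperator (𝕜₁ := ℂ) (𝕜₂ := ℂ) (σ₁₂ := RingHom.id ℂ)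
    (M₁ := DruryArveson d) (M₂ := DruryArveson d)).closure_subset
    (Metric.mem_closure_iff.2 fun ε hε => ?_)
  obtain ⟨s, hs⟩ := h (ε / 2) (by positivity)
  refine ⟨diagonal c C hc * proj s, (isCompactOperator_proj s).clm_comp (diagonal c C hc), ?_⟩
  rw [dist_eq_norm]
  refine lt_of_le_of_lt (ContinuousLinearMap.opNorm_le_bound _ (half_pos hε).le fun f =>
    norm_le_of_norm_coeff_le (half_pos hε).le fun α => ?_) (half_lt_self hε)
  rw [sub_apply, coeff_sub, mul_apply_eq_comp, coeff_diagonal,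
    coeff_diagonal, coeff_proj]
  split_ifs with hα
  · simp; positivity
  · rw [mul_zero, sub_zero, norm_mul]
    gcongr
    exact hs α hα

end DruryArveson

namespace DruryArveson

variable {d : ℕ}

/-! ### Relations between the coordinate multiplications -/

/-- The diagonal operator `(N + 1)⁻¹`, where `N` is the number operator `z^α ↦ |α| z^α`. -/
def numberInv (d : ℕ) : DruryArveson d →L[ℂ] DruryArveson d :=
  diagonal (fun α => ((∑ j, α j : ℕ) + 1 : ℂ)⁻¹) 1 fun α => by
    rw [norm_inv, ← Nat.cast_add_one, Complex.norm_natCast]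
    exact inv_le_one_of_one_le₀ (by exact_mod_cast Nat.le_add_left 1 _)

lemma coeff_numberInv (f : DruryArveson d) (α : Fin d →₀ ℕ) :
    coeff α (numberInv d f) = ((∑ j, α j : ℕ) + 1 : ℂ)⁻¹ * coeff α f := rfl

lemma isCompactOperator_numberInv (d : ℕ) : IsCompactOperator (numberInv d) := by
  refine isCompactOperator_diagonal _ _ _ fun ε hε => ?_
  obtain ⟨N, hN⟩ := exists_nat_gt ε⁻¹
  refine ⟨(Finsupp.finite_of_degree_le (σ := Fin d) N).toFinset, fun α hα => ?_⟩
  have hα' : N < ∑ j, α j := by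
    simpa [Finsupp.degree_eq_sum] using hα
  rw [norm_inv, ← Nat.cast_add_one, Complex.norm_natCast]
  refine inv_le_of_inv_le₀ hε (hN.le.trans ?_)
  exact_mod_cast (Nat.le_succ_of_le hα'.le)

lemma eq_single_add_of_ne_zero {α : Fin d →₀ ℕ} {i : Fin d} (h : α i ≠ 0) :
    ∃ β : Fin d →₀ ℕ, α = Finsupp.single i 1 + β :=
  ⟨α - Finsupp.single i 1, (add_tsub_cancel_of_le (by
    simpa [Finsupp.single_le_iff] using Nat.one_le_iff_ne_zero.2 h)).symm⟩

lemma coeff_mulCoord_star_mulCoord (i : Fin d) (f : DruryArveson d) (α : Fin d →₀ ℕ) :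
    coeff α (mulCoord i (star (mulCoord i) f)) = α i / (∑ j, α j : ℕ) * coeff α f := by
  by_cases h : α i = 0
  · rw [coeff_mulCoord_of_eq_zero i _ h, h]
    simp
  · obtain ⟨β, rfl⟩ := eq_single_add_of_ne_zero h
    rw [coeff_mulCoord_add, coeff_star_mulCoord, sum_add_single]
    simp [add_comm]

/-- `∑ M_{z_i} M_{z_i}^*` is the projection onto the orthogonal complement of the constants. -/
lemma sum_mulCoord_mul_star (d : ℕ) :
    ∑ i : Fin d, mulCoord i * star (mulCoord i) = 1 - proj {0} := by
  classical
  refine ContinuousLinearMap.ext fun f => ext_coeff fun α => ?_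
  rw [sum_apply, coeff_sum]
  simp only [mul_apply_eq_comp, coeff_mulCoord_star_mulCoord, sub_apply, one_apply_eq_self,
    coeff_sub, coeff_proj, Finset.mem_singleton]
  rw [← Finset.sum_mul, ← Finset.sum_div]
  split_ifs with h
  · simp [h]
  · have h1 : ((∑ j, α j : ℕ) : ℂ) ≠ 0 := by
      rw [Nat.cast_ne_zero]
      exact fun h2 => h (Finsupp.ext fun j => by simpa using Finset.sum_eq_zero_iff.1 h2 j)
    rw [← Nat.cast_sum, div_self h1, one_mul, sub_zero]

/-- The commutation relation between `M_{z_i}^*` and `M_{z_j}`. -/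
lemma star_mulCoord_mul_sub (i j : Fin d) :
    star (mulCoord i) * mulCoord j - mulCoord j * star (mulCoord i) =
      ((if i = j then 1 else 0) - mulCoord j * star (mulCoord i)) * numberInv d := by
  refine ContinuousLinearMap.ext fun f => ext_coeff fun α => ?_
  have hδ : ∀ g : DruryArveson d,
      coeff α ((if i = j then (1 : DruryArveson d →L[ℂ] DruryArveson d) else 0) g) =
        (if i = j then 1 else 0) * coeff α g := fun g => by
    split_ifs
    · simp
    · rw [zero_mul]
      exact (coeffLinear α).map_zero
  simp only [mul_apply_eq_comp, sub_apply, coeff_sub, hδ, coeff_numberInv, coeff_star_mulCoord]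
  have hn : ∀ n : ℕ, (n : ℂ) + 1 ≠ 0 := fun n => by exact_mod_cast n.succ_ne_zero
  by_cases h : α j = 0
  · rw [coeff_mulCoord_of_eq_zero j _ h, coeff_mulCoord_of_eq_zero j _ h]
    split_ifs with hij
    · subst hij
      rw [coeff_mulCoord_add, h]
      simp
    · rw [coeff_mulCoord_of_eq_zero j _ (by simp [h, hij])]
      simp
  · obtain ⟨β, rfl⟩ := eq_single_add_of_ne_zero h
    rw [coeff_mulCoord_add, coeff_mulCoord_add, add_left_comm, coeff_mulCoord_add,
      coeff_star_mulCoord, coeff_star_mulCoord, coeff_numberInv, sum_add_single, sum_add_single]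
    have h1 := hn (∑ j, β j)
    have h2 := hn (∑ j, β j + 1)
    split_ifs with hij
    · subst hij
      push_cast [Finsupp.add_apply, Finsupp.single_eq_same] at h1 h2 ⊢
      field_simp
      ring
    · push_cast [Finsupp.add_apply, Finsupp.single_eq_of_ne hij] at h1 h2 ⊢
      field_simp
      ring

lemma isCompactOperator_star_mulCoord_mul_sub (i j : Fin d) :
    IsCompactOperator (star (mulCoord i) * mulCoord j - mulCoord j * star (mulCoord i) :
      DruryArveson d →L[ℂ] DruryArveson d) := by
  rw [star_mulCoord_mul_sub]
  exact (isCompactOperator_numberInv d).clm_comp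
    ((if i = j then 1 else 0) - mulCoord j * star (mulCoord i) :
      DruryArveson d →L[ℂ] DruryArveson d)

lemma mulCoord_mul_comm (i j : Fin d) : mulCoord i * mulCoord j = mulCoord j * mulCoord i :=
  ContinuousLinearMap.ext fun _ => toSeries_injective (mul_left_comm _ _ _)

/-! ### The compact operators belong to the Toeplitz algebra -/

open InnerProductSpace (rankOne)

lemma mulCoord_mem_toeplitzAlgebra (i : Fin d) : mulCoord i ∈ toeplitzAlgebra d :=
  (toeplitzCoord i).2

lemma rankOne_mono_zero_mem_toeplitzAlgebra (d : ℕ) :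
    rankOne ℂ (mono 0) (mono (0 : Fin d →₀ ℕ)) ∈ toeplitzAlgebra d := by
  have h : rankOne ℂ (mono 0) (mono (0 : Fin d →₀ ℕ)) =
      1 - ∑ i : Fin d, mulCoord i * star (mulCoord i) := by
    rw [sum_mulCoord_mul_star, sub_sub_cancel, proj, Finset.sum_singleton]
    simp [weight]
  rw [h]
  exact sub_mem (one_mem _) (sum_mem fun i _ =>
    mul_mem (mulCoord_mem_toeplitzAlgebra i) (star_mem (mulCoord_mem_toeplitzAlgebra i)))

lemma rankOne_mono_add_mem_toeplitzAlgebra (α : Fin d →₀ ℕ) : ∀ (β : Fin d →₀ ℕ)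
    (y : DruryArveson d), rankOne ℂ (mono β) y ∈ toeplitzAlgebra d →
      rankOne ℂ (mono (α + β)) y ∈ toeplitzAlgebra d := by
  induction α using Finsupp.induction_linear with
  | zero => intro β y h; simpa using h
  | add f g hf hg =>
    intro β y h
    rw [add_assoc]
    exact hf _ _ (hg _ _ h)
  | single i n =>
    induction n with
    | zero => intro β y h; simpa using h
    | succ n ih =>
      intro β y h
      rw [add_comm n 1, Finsupp.single_add, add_assoc, ← mulCoord_mono]
      have := mul_mem (mulCoord_mem_toeplitzAlgebra i) (ih β y h)
      rwa [ContinuousLinearMap.mul_def, InnerProductSpace.comp_rankOne] at this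

lemma rankOne_mono_mono_mem_toeplitzAlgebra (α β : Fin d →₀ ℕ) :
    rankOne ℂ (mono α) (mono β) ∈ toeplitzAlgebra d := by
  have h := star_mem (rankOne_mono_add_mem_toeplitzAlgebra β 0 _
    (rankOne_mono_zero_mem_toeplitzAlgebra d))
  rw [ContinuousLinearMap.star_eq_adjoint, InnerProductSpace.adjoint_rankOne, add_zero] at h
  simpa using rankOne_mono_add_mem_toeplitzAlgebra α 0 _ h

lemma rankOne_mono_right_mem_toeplitzAlgebra (f : DruryArveson d) (β : Fin d →₀ ℕ) :
    rankOne ℂ f (mono β) ∈ toeplitzAlgebra d := by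
  have hc : Filter.Tendsto (fun s => rankOne ℂ (proj s f) (mono β)) Filter.atTop
      (nhds (rankOne ℂ f (mono β))) :=
    (((rankOne ℂ (E := DruryArveson d) (F := DruryArveson d)).flip (mono β)).continuous.tendsto
      f).comp (tendsto_proj_apply f)
  refine (StarSubalgebra.isClosed_topologicalClosure _).mem_of_tendsto hc
    (Filter.Eventually.of_forall fun s => ?_)
  have : rankOne ℂ (proj s f) (mono β) = ∑ α ∈ s, coeff α f • rankOne ℂ (mono α) (mono β) := by
    rw [proj_apply, map_sum, sum_apply]
    simp
  change _ ∈ toeplitzAlgebra d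
  rw [this]
  exact sum_mem fun α _ => SMulMemClass.smul_mem _ (rankOne_mono_mono_mem_toeplitzAlgebra α β)

lemma compactOperators_le_toeplitzAlgebra (d : ℕ) :
    compactOperators d ≤ (toeplitzAlgebra d).toNonUnitalStarSubalgebra := by
  intro T hT
  refine (StarSubalgebra.isClosed_topologicalClosure _).closure_subset
    (Metric.mem_closure_iff.2 fun ε hε => ?_)
  obtain ⟨s, hs⟩ := exists_norm_mul_one_sub_proj_le (T := T) hT (half_pos hε)
  refine ⟨T * proj s, ?_, ?_⟩
  · change T * proj s ∈ toeplitzAlgebra d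
    rw [proj, Finset.mul_sum]
    refine sum_mem fun α _ => ?_
    rw [mul_smul_comm, ContinuousLinearMap.mul_def, InnerProductSpace.comp_rankOne]
    exact SMulMemClass.smul_mem _ (rankOne_mono_right_mem_toeplitzAlgebra _ _)
  · rw [dist_eq_norm, show T - T * proj s = T * (1 - proj s) by rw [mul_sub, mul_one]]
    exact (hs s le_rfl).trans_lt (half_lt_self hε)

/-! ### Approximate eigenvectors of the adjoint coordinate multiplications -/

/-- The power `⟨z, ζ⟩^n` of a linear form. -/
def linearPow (ζ : Fin d → ℂ) (n : ℕ) : DruryArveson d :=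
  ((∑ i, conj (ζ i) • mulCoord i : DruryArveson d →L[ℂ] DruryArveson d) ^ n) (mono 0)

lemma linearPow_zero (ζ : Fin d → ℂ) : linearPow ζ 0 = mono 0 := rfl

lemma linearPow_succ (ζ : Fin d → ℂ) (n : ℕ) :
    linearPow ζ (n + 1) = ∑ i, conj (ζ i) • mulCoord i (linearPow ζ n) := by
  rw [linearPow, pow_succ', mul_apply_eq_comp, sum_apply]
  rfl

lemma coeff_linearPow_of_ne (ζ : Fin d → ℂ) {n : ℕ} : ∀ {α : Fin d →₀ ℕ}, ∑ j, α j ≠ n →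
    coeff α (linearPow ζ n) = 0 := by
  induction n with
  | zero =>
    intro α h
    rw [linearPow_zero, coeff_mono, if_neg]
    rintro rfl
    simp at h
  | succ n ih =>
    intro α h
    rw [linearPow_succ, coeff_sum]
    refine Finset.sum_eq_zero fun i _ => ?_
    rw [coeff_smul]
    by_cases hi : α i = 0
    · rw [coeff_mulCoord_of_eq_zero i _ hi, mul_zero]
    · obtain ⟨β, rfl⟩ := eq_single_add_of_ne_zero hi
      rw [coeff_mulCoord_add, ih, mul_zero]
      rw [sum_add_single] at h
      omega

lemma numberInv_linearPow (ζ : Fin d → ℂ) (n : ℕ) :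
    numberInv d (linearPow ζ n) = ((n : ℂ) + 1)⁻¹ • linearPow ζ n := by
  refine ext_coeff fun α => ?_
  rw [coeff_numberInv, coeff_smul]
  by_cases h : ∑ j, α j = n
  · rw [h]
  · rw [coeff_linearPow_of_ne ζ h, mul_zero, mul_zero]

lemma star_mulCoord_mulCoord_linearPow (ζ : Fin d → ℂ) (i j : Fin d) (n : ℕ) :
    star (mulCoord i) (mulCoord j (linearPow ζ n)) =
      ((n : ℂ) + 1)⁻¹ • ((if i = j then linearPow ζ n else 0) +
        (n : ℂ) • mulCoord j (star (mulCoord i) (linearPow ζ n))) := by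
  have h := DFunLike.congr_fun (star_mulCoord_mul_sub i j) (linearPow ζ n)
  have hn : (n : ℂ) + 1 ≠ 0 := by exact_mod_cast n.succ_ne_zero
  simp only [mul_apply_eq_comp, sub_apply, numberInv_linearPow, map_smul] at h
  rw [sub_eq_iff_eq_add] at h
  have h2 : (if i = j then (1 : DruryArveson d →L[ℂ] DruryArveson d) else 0) (linearPow ζ n) =
      if i = j then linearPow ζ n else 0 := by split_ifs <;> simp
  rw [h, h2]
  set x := mulCoord j (star (mulCoord i) (linearPow ζ n))
  have h3 : x = ((n : ℂ) + 1)⁻¹ • (((n : ℂ) + 1) • x) := by rw [smul_smul, inv_mul_cancel₀ hn, one_smul]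
  nth_rewrite 2 [h3]
  rw [add_smul, one_smul, smul_add, smul_add]
  module

lemma star_mulCoord_linearPow_succ (ζ : Fin d → ℂ) (i : Fin d) (n : ℕ) :
    star (mulCoord i) (linearPow ζ (n + 1)) = conj (ζ i) • linearPow ζ n := by
  have key : ∀ n : ℕ, (n : ℂ) • ∑ j, conj (ζ j) • mulCoord j (star (mulCoord i) (linearPow ζ n)) =
      (n : ℂ) • conj (ζ i) • linearPow ζ n →
      star (mulCoord i) (linearPow ζ (n + 1)) = conj (ζ i) • linearPow ζ n := fun n h => by
    have hn : (n : ℂ) + 1 ≠ 0 := by exact_mod_cast n.succ_ne_zero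
    have hj : ∀ j, conj (ζ j) • star (mulCoord i) (mulCoord j (linearPow ζ n)) =
        ((n : ℂ) + 1)⁻¹ • ((if i = j then conj (ζ j) • linearPow ζ n else 0) +
          (n : ℂ) • conj (ζ j) • mulCoord j (star (mulCoord i) (linearPow ζ n))) := fun j => by
      rw [star_mulCoord_mulCoord_linearPow]
      split_ifs <;> module
    rw [linearPow_succ, map_sum]
    simp only [map_smul, hj]
    rw [← Finset.smul_sum, Finset.sum_add_distrib, ← Finset.smul_sum, h, Finset.sum_ite_eq,
      if_pos (Finset.mem_univ i)]
    nth_rewrite 1 [← one_smul ℂ (conj (ζ i) • linearPow ζ n)]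
    rw [← add_smul, smul_smul, add_comm (1 : ℂ), inv_mul_cancel₀ hn, one_smul]
  induction n with
  | zero => exact key 0 (by simp)
  | succ n ih =>
    refine key (n + 1) ?_
    rw [ih, linearPow_succ]
    congr 1
    rw [Finset.smul_sum]
    refine Finset.sum_congr rfl fun j _ => ?_
    rw [map_smul, smul_comm]

lemma norm_linearPow {ζ : Fin d → ℂ} (hζ : ∑ i, ζ i * conj (ζ i) = 1) (n : ℕ) :
    ‖linearPow ζ n‖ = 1 := by
  have h : inner ℂ (linearPow ζ n) (linearPow ζ n) = 1 := by
    induction n with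
    | zero =>
      rw [linearPow_zero, inner_mono]
      simp [coeff_mono, weight]
    | succ n ih =>
      conv_lhs => rw [linearPow_succ]
      rw [sum_inner]
      calc _ = ∑ i, ζ i * conj (ζ i) := Finset.sum_congr rfl fun i _ => by
            rw [inner_smul_left, ← ContinuousLinearMap.adjoint_inner_right,
              ← ContinuousLinearMap.star_eq_adjoint, ← linearPow_succ,
              star_mulCoord_linearPow_succ, inner_smul_right, ih]
            simp
        _ = 1 := hζ
  rw [@norm_eq_sqrt_re_inner ℂ, h]
  simp

lemma inner_linearPow_of_ne (ζ : Fin d → ℂ) {m n : ℕ} (h : m ≠ n) :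
    inner ℂ (linearPow ζ m) (linearPow ζ n) = 0 := by
  rw [inner_def]
  refine (tsum_congr fun α => ?_).trans tsum_zero
  by_cases hα : ∑ j, α j = m
  · rw [coeff_linearPow_of_ne ζ (hα.trans_ne h)]
    simp
  · rw [coeff_linearPow_of_ne ζ hα]
    simp

lemma norm_sum_linearPow_sq {ζ : Fin d → ℂ} (hζ : ∑ i, ζ i * conj (ζ i) = 1) (m n : ℕ) :
    ‖∑ k ∈ Finset.range n, linearPow ζ (m + k)‖ ^ 2 = n := by
  have h : Orthonormal ℂ fun k => linearPow ζ (m + k) :=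
    ⟨fun k => norm_linearPow hζ _, fun k l hkl => inner_linearPow_of_ne ζ (by omega)⟩
  have h2 := h.inner_sum (fun _ => 1) (fun _ => 1) (Finset.range n)
  simp only [one_smul, map_one, mul_one, Finset.sum_const, Finset.card_range, nsmul_one,
    inner_self_eq_norm_sq_to_K] at h2
  have h3 : ((‖∑ k ∈ Finset.range n, linearPow ζ (m + k)‖ ^ 2 : ℝ) : ℂ) = ((n : ℝ) : ℂ) := by
    push_cast
    exact h2
  exact Complex.ofReal_injective h3

lemma star_sub_sum_linearPow (ζ : Fin d → ℂ) (i : Fin d) (m n : ℕ) :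
    star (mulCoord i - algebraMap ℂ _ (ζ i)) (∑ k ∈ Finset.range n, linearPow ζ (m + 1 + k)) =
      conj (ζ i) • (linearPow ζ m - linearPow ζ (m + n)) := by
  have h : star (algebraMap ℂ (DruryArveson d →L[ℂ] DruryArveson d) (ζ i)) =
      algebraMap ℂ _ (conj (ζ i)) := (algebraMap_star_comm (ζ i)).symm
  rw [star_sub, h, sub_apply, map_sum, ContinuousLinearMap.algebraMap_apply, Finset.smul_sum,
    ← Finset.sum_sub_distrib]
  have h2 := Finset.sum_range_sub' (fun k => linearPow ζ (m + k)) n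
  rw [add_zero] at h2
  rw [← h2, Finset.smul_sum]
  refine Finset.sum_congr rfl fun k _ => ?_
  rw [add_right_comm, star_mulCoord_linearPow_succ, smul_sub, add_assoc]

/-- For `ζ` in the sphere, `∑ (M_{z_i} - ζ_i)(M_{z_i} - ζ_i)^*` is not left invertible modulo the
compact operators. -/
lemma not_isCompactOperator_mul_sum_sub_one {ζ : Fin d → ℂ} (hζ : ∑ i, ζ i * conj (ζ i) = 1)
    (B : DruryArveson d →L[ℂ] DruryArveson d) :
    ¬ IsCompactOperator (B * ∑ i, (mulCoord i - algebraMap ℂ _ (ζ i)) *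
      star (mulCoord i - algebraMap ℂ _ (ζ i)) - 1 : DruryArveson d →L[ℂ] DruryArveson d) := by
  classical
  intro hC
  set A : DruryArveson d →L[ℂ] DruryArveson d := ∑ i, (mulCoord i - algebraMap ℂ _ (ζ i)) *
      star (mulCoord i - algebraMap ℂ _ (ζ i)) with hA
  obtain ⟨s, hs⟩ := exists_norm_mul_one_sub_proj_le hC (half_pos one_pos)
  replace hs := hs s le_rfl
  set m := s.sup fun α => ∑ j, α j
  set D : DruryArveson d →L[ℂ] DruryArveson d :=
    ∑ i, conj (ζ i) • (mulCoord i - algebraMap ℂ _ (ζ i)) with hD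
  set v : ℕ → DruryArveson d := fun n => ∑ k ∈ Finset.range n, linearPow ζ (m + 1 + k) with hv
  have hAv : ∀ n, A (v n) = D (linearPow ζ m - linearPow ζ (m + n)) := fun n => by
    simp only [hA, hD, hv, sum_apply, mul_apply_eq_comp, star_sub_sum_linearPow, map_smul,
      smul_apply]
  have hPv : ∀ n, proj s (v n) = 0 := fun n => by
    rw [proj_apply]
    refine Finset.sum_eq_zero fun α hα => ?_
    have hαm : ∑ j, α j ≤ m := Finset.le_sup (f := fun α : Fin d →₀ ℕ => ∑ j, α j) hα
    rw [coeff_sum, Finset.sum_eq_zero fun k _ => coeff_linearPow_of_ne ζ (by omega), zero_smul]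
  have hbound : ∀ n, ‖v n‖ ≤ 4 * (‖B‖ * ‖D‖) := fun n => by
    have h1 : (B * A - 1) (v n) = ((B * A - 1) * (1 - proj s)) (v n) := by
      simp [hPv]
    have h2 : v n = B (A (v n)) - (B * A - 1) (v n) := by simp
    have h3 : ‖(B * A - 1) (v n)‖ ≤ 1 / 2 * ‖v n‖ := by
      rw [h1]
      exact ContinuousLinearMap.le_of_opNorm_le _ hs _
    have h4 : ‖B (A (v n))‖ ≤ ‖B‖ * (‖D‖ * 2) := by
      refine B.le_opNorm_of_le ?_
      rw [hAv]
      refine D.le_opNorm_of_le ((norm_sub_le _ _).trans ?_)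
      rw [norm_linearPow hζ, norm_linearPow hζ]
      norm_num
    have h5 : ‖v n‖ ≤ ‖B (A (v n))‖ + ‖(B * A - 1) (v n)‖ := by
      conv_lhs => rw [h2]
      exact norm_sub_le _ _
    linarith
  obtain ⟨n, hn⟩ := exists_nat_gt ((4 * (‖B‖ * ‖D‖)) ^ 2)
  have h6 := norm_sum_linearPow_sq hζ (m + 1) n
  have h7 := pow_le_pow_left₀ (norm_nonneg _) (hbound n) 2
  rw [h6] at h7
  linarith

end DruryArveson

namespace DruryArveson

variable {d : ℕ}

/-! ### The quotient of the Toeplitz algebra by the compact operators -/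

lemma commutator_mem_compactOperators_of_generators {S : DruryArveson d →L[ℂ] DruryArveson d}
    (hS : ∀ i, mulCoord i * S - S * mulCoord i ∈ compactOperators d ∧
      mulCoord i * star S - star S * mulCoord i ∈ compactOperators d)
    {T : DruryArveson d →L[ℂ] DruryArveson d} (hT : T ∈ toeplitzAlgebra d) :
    T * S - S * T ∈ compactOperators d ∧ T * star S - star S * T ∈ compactOperators d := by
  have hcl : IsClosed {T : DruryArveson d →L[ℂ] DruryArveson d |
      T * S - S * T ∈ compactOperators d ∧ T * star S - star S * T ∈ compactOperators d} := by
    have hK : IsClosed (compactOperators d : Set (DruryArveson d →L[ℂ] DruryArveson d)) :=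
      inferInstance
    exact (hK.preimage (by fun_prop : Continuous fun T => T * S - S * T)).inter
      (hK.preimage (by fun_prop : Continuous fun T => T * star S - star S * T))
  have hl : ∀ T {K : DruryArveson d →L[ℂ] DruryArveson d}, K ∈ compactOperators d →
      T * K ∈ compactOperators d := fun T _ hK => IsCompactOperator.clm_comp hK T
  have hr : ∀ T {K : DruryArveson d →L[ℂ] DruryArveson d}, K ∈ compactOperators d →
      K * T ∈ compactOperators d := fun T _ hK => IsCompactOperator.comp_clm hK T
  have hmul : ∀ (S X Y : DruryArveson d →L[ℂ] DruryArveson d),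
      X * S - S * X ∈ compactOperators d → Y * S - S * Y ∈ compactOperators d →
      X * Y * S - S * (X * Y) ∈ compactOperators d := fun S X Y hX hY => by
    rw [show X * Y * S - S * (X * Y) = X * (Y * S - S * Y) + (X * S - S * X) * Y by noncomm_ring]
    exact add_mem (hl X hY) (hr Y hX)
  have hadd : ∀ (S X Y : DruryArveson d →L[ℂ] DruryArveson d),
      X * S - S * X ∈ compactOperators d → Y * S - S * Y ∈ compactOperators d →
      (X + Y) * S - S * (X + Y) ∈ compactOperators d := fun S X Y hX hY => by
    rw [show (X + Y) * S - S * (X + Y) = (X * S - S * X) + (Y * S - S * Y) by noncomm_ring]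
    exact add_mem hX hY
  refine hcl.closure_subset_iff.2 (fun T hT => ?_) hT
  induction hT using StarAlgebra.adjoin_induction with
  | mem x hx =>
    obtain ⟨i, rfl⟩ := hx
    exact hS i
  | algebraMap r =>
    constructor <;> rw [Algebra.commutes, sub_self] <;> exact zero_mem _
  | add x y _ _ hx hy => exact ⟨hadd _ _ _ hx.1 hy.1, hadd _ _ _ hx.2 hy.2⟩
  | mul x y _ _ hx hy => exact ⟨hmul _ _ _ hx.1 hy.1, hmul _ _ _ hx.2 hy.2⟩
  | star x _ hx =>
    refine ⟨?_, ?_⟩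
    · have := neg_mem (star_mem hx.2)
      simpa using this
    · have := neg_mem (star_mem hx.1)
      simpa using this

/-- The Toeplitz algebra is commutative modulo the compact operators. -/
lemma commutator_mem_compactOperators {S T : DruryArveson d →L[ℂ] DruryArveson d}
    (hS : S ∈ toeplitzAlgebra d) (hT : T ∈ toeplitzAlgebra d) :
    T * S - S * T ∈ compactOperators d := by
  have h1 : ∀ i, ∀ T ∈ toeplitzAlgebra d, mulCoord i * T - T * mulCoord i ∈ compactOperators d :=
    fun i T hT => by
      rw [← neg_sub]
      refine neg_mem (commutator_mem_compactOperators_of_generators (fun j => ⟨?_, ?_⟩) hT).1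
      · rw [mulCoord_mul_comm, sub_self]
        exact zero_mem _
      · rw [← neg_sub]
        exact neg_mem (isCompactOperator_star_mulCoord_mul_sub i j :
          _ ∈ compactOperators d)
  exact (commutator_mem_compactOperators_of_generators
    (fun i => ⟨h1 i S hS, h1 i _ (star_mem hS)⟩) hT).1

/-- The ideal of compact operators in the Toeplitz algebra. -/
def compactIdeal (d : ℕ) : Ideal (toeplitzAlgebra d) where
  carrier := {T | IsCompactOperator T.1}
  add_mem' hS hT := hS.add hT
  zero_mem' := isCompactOperator_zero
  smul_mem' T _ hS := IsCompactOperator.clm_comp hS T.1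

instance (d : ℕ) : (compactIdeal d).IsTwoSided :=
  ⟨fun {_} b ha => IsCompactOperator.comp_clm ha b.1⟩

lemma proj_mem_compactOperators (s : Finset (Fin d →₀ ℕ)) : proj s ∈ compactOperators d :=
  isCompactOperator_proj s

lemma isClosed_compactIdeal (d : ℕ) : IsClosed (compactIdeal d : Set (toeplitzAlgebra d)) := by
  have hK : IsClosed (compactOperators d : Set (DruryArveson d →L[ℂ] DruryArveson d)) :=
    inferInstance
  exact hK.preimage continuous_subtype_val

/-- The quotient `𝒯_d / 𝒦`. -/
def ToeplitzQuotient (d : ℕ) : Type := toeplitzAlgebra d ⧸ compactIdeal d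

instance (d : ℕ) : CommCStarAlgebra (ToeplitzQuotient d) :=
  Ideal.Quotient.commCStarAlgebra (compactIdeal d)
    (isClosed_compactIdeal d)
    (fun T hT => isCompactOperator_star T.1 hT)
    (fun T hT ε hε => by
      obtain ⟨s, hs⟩ := exists_norm_mul_one_sub_proj_le hT hε
      exact ⟨⟨proj s, compactOperators_le_toeplitzAlgebra d (proj_mem_compactOperators s)⟩,
        proj_mem_compactOperators s, norm_one_sub_proj_le s, hs s le_rfl⟩)
    fun S T => commutator_mem_compactOperators T.2 S.2

/-- The quotient map `𝒯_d → 𝒯_d / 𝒦`. -/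
def toeplitzQuotientMap (d : ℕ) : toeplitzAlgebra d →⋆ₐ[ℂ] ToeplitzQuotient d where
  toFun := Ideal.Quotient.mk (compactIdeal d)
  map_one' := rfl
  map_mul' _ _ := rfl
  map_zero' := rfl
  map_add' _ _ := rfl
  commutes' _ := rfl
  map_star' _ := rfl

lemma toeplitzQuotientMap_surjective (d : ℕ) : Function.Surjective (toeplitzQuotientMap d) :=
  Ideal.Quotient.mk_surjective

lemma toeplitzQuotientMap_eq_zero_iff {T : toeplitzAlgebra d} :
    toeplitzQuotientMap d T = 0 ↔ IsCompactOperator T.1 :=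
  Ideal.Quotient.eq_zero_iff_mem (I := compactIdeal d)

lemma toeplitzQuotientMap_eq_iff {S T : toeplitzAlgebra d} :
    toeplitzQuotientMap d S = toeplitzQuotientMap d T ↔ IsCompactOperator (S.1 - T.1) := by
  rw [← sub_eq_zero, ← map_sub, toeplitzQuotientMap_eq_zero_iff]
  rfl

/-! ### The characters of the quotient -/

open WeakDual

/-- The image of `M_{z_i}` in `𝒯_d / 𝒦`. -/
def quotientCoord (i : Fin d) : ToeplitzQuotient d := toeplitzQuotientMap d (toeplitzCoord i)

lemma sum_quotientCoord_mul_star (d : ℕ) :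
    ∑ i : Fin d, quotientCoord i * star (quotientCoord i) = 1 := by
  have h : toeplitzQuotientMap d (∑ i, toeplitzCoord i * star (toeplitzCoord i)) =
      toeplitzQuotientMap d 1 := by
    rw [toeplitzQuotientMap_eq_iff]
    have : ((∑ i, toeplitzCoord i * star (toeplitzCoord i) : toeplitzAlgebra d) :
        DruryArveson d →L[ℂ] DruryArveson d) = 1 - proj {0} := by
      rw [← sum_mulCoord_mul_star, AddSubmonoidClass.coe_finsetSum]
      rfl
    rw [this]
    change (1 - proj {0}) - 1 ∈ compactOperators d
    rw [sub_sub_cancel_left]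
    exact neg_mem (proj_mem_compactOperators _)
  simpa only [quotientCoord, map_sum, map_mul, map_star, map_one] using h

lemma character_ext {χ η : characterSpace ℂ (ToeplitzQuotient d)}
    (h : ∀ i, χ (quotientCoord i) = η (quotientCoord i)) : χ = η := by
  have hc : Continuous (toeplitzQuotientMap d) :=
    AddMonoidHomClass.continuous_of_bound _ 1 fun T => by
      rw [one_mul]
      exact Ideal.Quotient.norm_mk_le_norm (compactIdeal d) T
  have key : (χ : ToeplitzQuotient d →⋆ₐ[ℂ] ℂ).comp (toeplitzQuotientMap d) =
      (η : ToeplitzQuotient d →⋆ₐ[ℂ] ℂ).comp (toeplitzQuotientMap d) := by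
    refine StarAlgHom.ext_topologicalClosure ((map_continuous χ).comp hc)
      ((map_continuous η).comp hc) (StarAlgHom.ext_adjoin fun x hx => ?_)
    obtain ⟨x, hx'⟩ := x
    obtain ⟨i, rfl⟩ := hx
    exact h i
  refine DFunLike.ext _ _ fun x => ?_
  obtain ⟨T, rfl⟩ := toeplitzQuotientMap_surjective d x
  exact DFunLike.congr_fun key T

/-- A character of `𝒯_d / 𝒦` as a point of the sphere. -/
def characterPoint (χ : characterSpace ℂ (ToeplitzQuotient d)) :
    Metric.sphere (0 : EuclideanSpace ℂ (Fin d)) 1 :=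
  ⟨WithLp.toLp 2 fun i => χ (quotientCoord i), by
    have h := congrArg χ (sum_quotientCoord_mul_star d)
    simp only [map_sum, map_mul, map_star, map_one] at h
    rw [mem_sphere_zero_iff_norm, EuclideanSpace.norm_eq, Real.sqrt_eq_one]
    refine Complex.ofReal_injective ?_
    rw [Complex.ofReal_one, ← h]
    push_cast
    exact Finset.sum_congr rfl fun i _ => (Complex.mul_conj' _).symm⟩

lemma characterPoint_apply (χ : characterSpace ℂ (ToeplitzQuotient d)) (i : Fin d) :
    (characterPoint χ).1 i = χ (quotientCoord i) := rfl

lemma continuous_characterPoint : Continuous (characterPoint (d := d)) := by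
  refine Continuous.subtype_mk ((PiLp.continuous_toLp 2 _).comp (continuous_pi fun i => ?_)) _
  exact (gelfandTransform ℂ _ (quotientCoord i)).continuous

lemma characterPoint_injective : Function.Injective (characterPoint (d := d)) := fun χ η h =>
  character_ext fun i => by rw [← characterPoint_apply, h, characterPoint_apply]

lemma characterPoint_surjective : Function.Surjective (characterPoint (d := d)) := by
  intro ζ
  have hζ : ∑ i, ζ.1 i * conj (ζ.1 i) = 1 := by
    have h := ζ.2
    rw [mem_sphere_zero_iff_norm, EuclideanSpace.norm_eq, Real.sqrt_eq_one] at h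
    simp only [Complex.mul_conj']
    exact_mod_cast h
  set A : toeplitzAlgebra d := ∑ i, (toeplitzCoord i - algebraMap ℂ _ (ζ.1 i)) *
    star (toeplitzCoord i - algebraMap ℂ _ (ζ.1 i)) with hA
  have hA' : (A : DruryArveson d →L[ℂ] DruryArveson d) =
      ∑ i, (mulCoord i - algebraMap ℂ _ (ζ.1 i)) * star (mulCoord i - algebraMap ℂ _ (ζ.1 i)) := by
    rw [hA, AddSubmonoidClass.coe_finsetSum]
    rfl
  have hunit : ¬ IsUnit (toeplitzQuotientMap d A) := by
    intro h
    obtain ⟨b, hb⟩ := h.exists_left_inv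
    obtain ⟨B, rfl⟩ := toeplitzQuotientMap_surjective d b
    rw [← map_mul, ← map_one (toeplitzQuotientMap d), toeplitzQuotientMap_eq_iff] at hb
    refine not_isCompactOperator_mul_sum_sub_one hζ B.1 ?_
    rw [← hA']
    exact hb
  obtain ⟨χ, hχ⟩ := WeakDual.CharacterSpace.exists_apply_eq_zero hunit
  refine ⟨χ, Subtype.ext (PiLp.ext fun i => ?_)⟩
  rw [characterPoint_apply]
  simp only [hA, map_sum, map_mul, map_star, map_sub, AlgHomClass.commutes] at hχ
  have h2 : ∑ i, ‖χ (quotientCoord i) - ζ.1 i‖ ^ 2 = 0 := by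
    refine Complex.ofReal_injective ?_
    rw [Complex.ofReal_zero, ← hχ]
    push_cast
    refine Finset.sum_congr rfl fun i _ => ?_
    rw [← Complex.mul_conj']
    simp [quotientCoord]
  have h3 := (Finset.sum_eq_zero_iff_of_nonneg fun i _ => by positivity).1 h2 i (Finset.mem_univ i)
  simpa [sub_eq_zero] using h3

/-- The character space of `𝒯_d / 𝒦` is the sphere. -/
def characterHomeomorph (d : ℕ) : characterSpace ℂ (ToeplitzQuotient d) ≃ₜ
    Metric.sphere (0 : EuclideanSpace ℂ (Fin d)) 1 :=
  Continuous.homeoOfEquivCompactToT2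
    (f := Equiv.ofBijective characterPoint ⟨characterPoint_injective, characterPoint_surjective⟩)
    continuous_characterPoint

/-- The isomorphism of `𝒯_d / 𝒦` with the continuous functions on the sphere. -/
def quotientEquiv (d : ℕ) : ToeplitzQuotient d ≃⋆ₐ[ℂ]
    C(Metric.sphere (0 : EuclideanSpace ℂ (Fin d)) 1, ℂ) :=
  (gelfandStarTransform (ToeplitzQuotient d)).trans
    ((characterHomeomorph d).symm.compStarAlgEquiv' ℂ ℂ)

lemma quotientEquiv_quotientCoord (i : Fin d) :
    quotientEquiv d (quotientCoord i) = sphereCoord i := by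
  ext z
  obtain ⟨χ, rfl⟩ := (characterHomeomorph d).surjective z
  change ((characterHomeomorph d).symm (characterHomeomorph d χ)) (quotientCoord i) = _
  rw [Homeomorph.symm_apply_apply]
  rfl

/-- The symbol map `𝒯_d → C(∂𝔹_d)`. -/
def symbolMap (d : ℕ) : toeplitzAlgebra d →⋆ₐ[ℂ]
    C(Metric.sphere (0 : EuclideanSpace ℂ (Fin d)) 1, ℂ) :=
  ((quotientEquiv d : ToeplitzQuotient d →⋆ₐ[ℂ] _)).comp (toeplitzQuotientMap d)

lemma symbolMap_apply (T : toeplitzAlgebra d) :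
    symbolMap d T = quotientEquiv d (toeplitzQuotientMap d T) := rfl

end DruryArveson

end

theorem mainTheorem4 (d : ℕ) :
    ∃ (hK : DruryArveson.compactOperators d ≤
          (DruryArveson.toeplitzAlgebra d).toNonUnitalStarSubalgebra)
      (π : DruryArveson.toeplitzAlgebra d →⋆ₐ[ℂ]
          C(Metric.sphere (0 : EuclideanSpace ℂ (Fin d)) 1, ℂ)),
      IsCStarShortExact
          (A := DruryArveson.compactOperators d) (B := DruryArveson.toeplitzAlgebra d)
          (NonUnitalStarSubalgebra.inclusion hK)
          (π : DruryArveson.toeplitzAlgebra d →⋆ₙₐ[ℂ]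
            C(Metric.sphere (0 : EuclideanSpace ℂ (Fin d)) 1, ℂ)) ∧
        ∀ i : Fin d, π (DruryArveson.toeplitzCoord i) = DruryArveson.sphereCoord i := by
  refine ⟨DruryArveson.compactOperators_le_toeplitzAlgebra d, DruryArveson.symbolMap d,
    ⟨NonUnitalStarSubalgebra.inclusion_injective _, fun T => ?_, ?_⟩,
    DruryArveson.quotientEquiv_quotientCoord⟩
  · change DruryArveson.symbolMap d T = 0 ↔ _
    rw [DruryArveson.symbolMap_apply, EmbeddingLike.map_eq_zero_iff,
      DruryArveson.toeplitzQuotientMap_eq_zero_iff]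
    constructor
    · exact fun h => ⟨⟨T.1, h⟩, rfl⟩
    · rintro ⟨K, rfl⟩
      exact K.2
  · exact (DruryArveson.quotientEquiv d).surjective.comp
      (DruryArveson.toeplitzQuotientMap_surjective d)
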